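/- Let $k\ge 2$ and $n\ge 1$ be integers. For a $k$-regular bipartite (simple) graph $G$ on $2n$ vertices, whose two colour classes then have $n$ vertices each, let $A_G\in\{0,1\}^{n\times n}$ be its bi-adjacency matrix (for any choice of the two classes and any enumeration of them). Put $$B_S(k,n)=\left(\frac{(k-1)^{k-1}}{k^{k-2}}\right)^n,\qquad \mathrm{perm}(A)=\sum_{\sigma\in S_n}\prod_{i=1}^n a_{i,\sigma(i)},$$ and, for a nonnegative $n\times n$ matrix $P$, let the Bethe permanent be $$\mathrm{perm}_{\mathrm B}(P)=\exp\Big(\max_{Q\in\Omega_n}\sum_{i,j}\Big[(1-Q_{ij})\log(1-Q_{ij})-Q_{ij}\log\frac{Q_{ij}}{P_{ij}}\Big]\Big),$$ where $\Omega_n$ is the set of doubly stochastic $n\times n$ matrices, $0\log 0=0\log\frac00=0$, and $q\log\frac q0=+\infty$ for $q>0$. Then for every such graph $G$ the number of perfect matchings of $G$ equals $\mathrm{perm}(A_G)$, and $$\mathrm{perm}(A_G)>\mathrm{perm}_{\mathrm B}(A_G)=B_S(k,n).$$ In particular, every such $G$ has strictly more than $B_S(k,n)$ perfect matchings; and whenever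 such graphs exist, i.e. for $k\le n$, the minimum $p(k,n)$ of the number of perfect matchings over all $k$-regular bipartite graphs on $2n$ vertices satisfies $p(k,n)>B_S(k,n)$. -/

import Mathlib

/-- `A` is a bi-adjacency matrix of the graph `G`: the vertex set of `G` is split into two classes
of `n` vertices each, enumerated by the left and the right summand of `Fin n ⊕ Fin n`, every edge
of `G` joins the two classes, and `A i j` is `1` or `0` according to whether the `i`-th vertex of
the first class is adjacent to the `j`-th vertex of the second class or not. -/
def IsBiadjacencyMatrix {V : Type*} {n : ℕ} (G : SimpleGraph V)
    (A : Matrix (Fin n) (Fin n) ℝ) : Prop :=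
  ∃ e : Fin n ⊕ Fin n ≃ V,
    (∀ i j, ¬ G.Adj (e (Sum.inl i)) (e (Sum.inl j))) ∧
    (∀ i j, ¬ G.Adj (e (Sum.inr i)) (e (Sum.inr j))) ∧
    ∀ i j, (G.Adj (e (Sum.inl i)) (e (Sum.inr j)) ∧ A i j = 1) ∨
      (¬ G.Adj (e (Sum.inl i)) (e (Sum.inr j)) ∧ A i j = 0)

/-- The number of perfect matchings of `G`. -/
noncomputable def numPerfectMatchings {V : Type*} (G : SimpleGraph V) : ℕ :=
  Nat.card {M : G.Subgraph // M.IsPerfectMatching}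

open Classical in
/-- `p(k, n)`: the minimum of the number of perfect matchings over all `k`-regular bipartite graphs
with `2 * n` vertices. (It is meaningful when there is such a graph, that is, for `k ≤ n`.) -/
noncomputable def minPerfectMatchings (k n : ℕ) : ℕ :=
  sInf {m : ℕ | ∃ G : SimpleGraph (Fin (2 * n)),
    G.IsBipartite ∧ G.IsRegularOfDegree k ∧ numPerfectMatchings G = m}

/-- Schrijver's bound. -/
noncomputable def schrijverBound (k n : ℕ) : ℝ :=
  (((k : ℝ) - 1) ^ (k - 1) / (k : ℝ) ^ (k - 2)) ^ n

/-- The functional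
`CW(P, Q) = ∑ i j, ((1 - Q i j) log (1 - Q i j) - Q i j log (Q i j / P i j))`, with `0 log 0 = 0`.
It is used only for `Q` vanishing wherever `P` does; the terms with `P i j = Q i j = 0` are `0`. -/
noncomputable def betheCW {n : ℕ} (P Q : Matrix (Fin n) (Fin n) ℝ) : ℝ :=
  ∑ i, ∑ j, ((1 - Q i j) * Real.log (1 - Q i j) - Q i j * Real.log (Q i j / P i j))

/-- The doubly stochastic matrices `Q` for which `CW(P, Q)` is finite, that is, those that
vanish wherever `P` does. For all other doubly stochastic `Q` the value `CW(P, Q)` is `-∞`. -/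
def betheDomain {n : ℕ} (P : Matrix (Fin n) (Fin n) ℝ) : Set (Matrix (Fin n) (Fin n) ℝ) :=
  {Q | Q ∈ doublyStochastic ℝ (Fin n) ∧ ∀ i j, P i j = 0 → Q i j = 0}

/-- The Bethe permanent `exp (max_Q CW(P, Q))` of a matrix `P` with nonnegative entries, where `Q`
ranges over the doubly stochastic matrices. If `CW(P, ·)` is identically `-∞`, the value is
`exp (-∞) = 0`; otherwise the supremum is a maximum, see `isGreatest_bethePermanent`. -/
noncomputable def bethePermanent {n : ℕ} (P : Matrix (Fin n) (Fin n) ℝ) : ℝ :=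
  sSup ((fun Q => Real.exp (betheCW P Q)) '' betheDomain P)

/-- The supremum that defines the Bethe permanent is attained. -/
theorem isGreatest_bethePermanent {n : ℕ} (P : Matrix (Fin n) (Fin n) ℝ)
    (h : (betheDomain P).Nonempty) :
    IsGreatest ((fun Q => Real.exp (betheCW P Q)) '' betheDomain P) (bethePermanent P) := by
  have hentry : ∀ i j, Continuous fun Q : Matrix (Fin n) (Fin n) ℝ => Q i j := by
    intro i j; fun_prop
  have hclosed : IsClosed (betheDomain P) := by
    have : betheDomain P = ((⋂ i, ⋂ j, {Q : Matrix (Fin n) (Fin n) ℝ | 0 ≤ Q i j}) ∩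
        (⋂ i, {Q : Matrix (Fin n) (Fin n) ℝ | ∑ j, Q i j = 1}) ∩
        (⋂ j, {Q : Matrix (Fin n) (Fin n) ℝ | ∑ i, Q i j = 1})) ∩
        (⋂ i, ⋂ j, {Q : Matrix (Fin n) (Fin n) ℝ | P i j = 0 → Q i j = 0}) := by
      ext Q
      simp only [betheDomain, mem_doublyStochastic_iff_sum, Set.mem_ofPred_eq, Set.mem_inter_iff,
        Set.mem_iInter, and_assoc]
    rw [this]
    refine IsClosed.inter (IsClosed.inter (IsClosed.inter ?_ ?_) ?_) ?_
    · exact isClosed_iInter fun i => isClosed_iInter fun j =>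
        isClosed_le continuous_const (hentry i j)
    · exact isClosed_iInter fun i => isClosed_eq (by fun_prop) continuous_const
    · exact isClosed_iInter fun i => isClosed_eq (by fun_prop) continuous_const
    · refine isClosed_iInter fun i => isClosed_iInter fun j => ?_
      by_cases hP : P i j = 0
      · simpa [hP] using isClosed_eq (hentry i j) continuous_const
      · simp [hP]
  have hcompact : IsCompact (betheDomain P) := by
    have hc : IsCompact (Set.pi Set.univ fun _ : Fin n =>
        Set.pi Set.univ fun _ : Fin n => Set.Icc (0 : ℝ) 1) :=
      isCompact_univ_pi fun _ => isCompact_univ_pi fun _ => isCompact_Icc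
    refine hc.of_isClosed_subset hclosed ?_
    exact fun Q hQ i _ j _ =>
      ⟨nonneg_of_mem_doublyStochastic hQ.1, le_one_of_mem_doublyStochastic hQ.1⟩
  have hcont : Continuous fun Q : Matrix (Fin n) (Fin n) ℝ => Real.exp (betheCW P Q) := by
    refine Real.continuous_exp.comp ?_
    unfold betheCW
    refine continuous_finsetSum _ fun i _ => continuous_finsetSum _ fun j _ => ?_
    refine Continuous.sub ?_ ?_
    · exact Real.continuous_mul_log.comp (continuous_const.sub (hentry i j))
    · by_cases hP : P i j = 0
      · simpa [hP] using continuous_const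
      · have : (fun Q : Matrix (Fin n) (Fin n) ℝ => Q i j * Real.log (Q i j / P i j)) =
            fun Q => P i j * (Q i j / P i j * Real.log (Q i j / P i j)) := by
          funext Q; field_simp
        rw [this]
        exact continuous_const.mul (Real.continuous_mul_log.comp ((hentry i j).div_const _))
  exact (hcompact.image hcont).isGreatest_sSup (h.image _)

/-! The lower bound on the permanent is Gurvits' capacity argument. The permanent of `A` is obtained
from the product of the coordinates `y i` by differentiating once in the direction of each column of
`A`. The product is nonzero on the open right half-plane, and by Gauss–Lucas this stability survives
differentiation in positive directions (`IsStableForm.deriv`). Along a column with at most `k`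
nonzero entries, a stable form is a real-rooted polynomial of degree at most `k`, so by AM-GM each
derivative costs the capacity at most a factor `g = ((k-1)/k)^(k-1)`
(`le_derivative_of_forall_mul_le_eval`). The last derivative is of a linear form and costs nothing,
leaving `g^(n-1)` times the capacity (`capacity_le_permanent`).

For a `k`-regular 0-1 matrix the capacity is at least `k^n` (`IsRegularZeroOne.mul_prod_le`).
Schrijver's bound is `(k g)^n`, so the factor saved at the last step gives strictness.

The Bethe functional splits into rows. Each row is bounded by `log (k g)` through Gibbs' and
Maclaurin's inequalities (`sum_bethe_row_le`), and the matrix `A / k` attains all these bounds at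
once. Perfect matchings correspond to the permutations with nonzero product in the permanent. -/

/-! ### Multi-affine stable forms and their directional derivatives. -/

section StableForms

open Polynomial Finset

variable {ι : Type*} [Fintype ι]

/-- The value at `y` of the multi-affine polynomial with coefficients `w`. -/
noncomputable def multiaffineEval {R : Type*} [CommRing R] [Algebra ℝ R] (w : Finset ι → ℝ)
    (y : ι → R) : R :=
  ∑ T, algebraMap ℝ R (w T) * ∏ i ∈ T, y i

/-- The coefficients of the derivative, in the direction `v`, of the multi-affine polynomial with
coefficients `w`. -/
def dirDeriv [DecidableEq ι] (v : ι → ℝ) (w : Finset ι → ℝ) (T : Finset ι) : ℝ :=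
  ∑ i ∈ Tᶜ, v i * w (insert i T)

theorem map_multiaffineEval {R S : Type*} [CommRing R] [Algebra ℝ R] [CommRing S] [Algebra ℝ S]
    (φ : R →ₐ[ℝ] S) (w : Finset ι → ℝ) (y : ι → R) :
    φ (multiaffineEval w y) = multiaffineEval w (fun i => φ (y i)) := by
  simp [multiaffineEval, map_sum, map_mul, map_prod]

theorem multiaffineEval_ofReal (w : Finset ι → ℝ) (y : ι → ℝ) :
    multiaffineEval w (fun i => (y i : ℂ)) = (multiaffineEval w y : ℝ) :=
  (map_multiaffineEval (Algebra.ofId ℝ ℂ) w y).symm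

/-- The restriction of a multi-affine polynomial to the line through `z` in the direction `v`. -/
noncomputable def linePoly {R : Type*} [CommRing R] [Algebra ℝ R] (w : Finset ι → ℝ)
    (z v : ι → R) : R[X] :=
  multiaffineEval w (fun i => C (z i) + C (v i) * X)

theorem eval_linePoly {R : Type*} [CommRing R] [Algebra ℝ R] (w : Finset ι → ℝ)
    (z v : ι → R) (t : R) :
    (linePoly w z v).eval t = multiaffineEval w (fun i => z i + v i * t) := by
  have := map_multiaffineEval ((Polynomial.aeval t).restrictScalars ℝ : R[X] →ₐ[ℝ] R) w
    (fun i => C (z i) + C (v i) * X)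
  simpa [linePoly, Polynomial.coe_aeval_eq_eval] using this

theorem multiaffineEval_dirDeriv [DecidableEq ι] {R : Type*} [CommRing R] [Algebra ℝ R] (w : Finset ι → ℝ)
    (v : ι → ℝ) (z : ι → R) :
    multiaffineEval (dirDeriv v w) z =
      ∑ T : Finset ι, ∑ i ∈ T,
        algebraMap ℝ R (w T) * ((∏ j ∈ T.erase i, z j) * algebraMap ℝ R (v i)) := by
  simp only [multiaffineEval, dirDeriv, map_sum, sum_mul]
  rw [sum_sigma', sum_sigma']
  refine sum_bij' (fun p _ => ⟨insert p.2 p.1, p.2⟩) (fun p _ => ⟨p.1.erase p.2, p.2⟩)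
    ?_ ?_ ?_ ?_ ?_
  · simp
  · simp
  · rintro ⟨T, i⟩ h
    simp only [mem_sigma, mem_univ, mem_compl, true_and] at h
    simp [erase_insert h]
  · rintro ⟨T, i⟩ h
    simp only [mem_sigma, mem_univ, true_and] at h
    simp [insert_erase h]
  · rintro ⟨T, i⟩ h
    simp only [mem_sigma, mem_univ, mem_compl, true_and] at h
    simp only [erase_insert h, map_mul]
    ring

theorem eval_derivative_linePoly [DecidableEq ι] {R : Type*} [CommRing R] [Algebra ℝ R] (w : Finset ι → ℝ)
    (z : ι → R) (v : ι → ℝ) :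
    (derivative (linePoly w z (fun i => algebraMap ℝ R (v i)))).eval 0 =
      multiaffineEval (dirDeriv v w) z := by
  rw [multiaffineEval_dirDeriv]
  simp only [linePoly, multiaffineEval, derivative_sum, eval_finsetSum]
  refine sum_congr rfl fun T _ => ?_
  have h : (algebraMap ℝ R[X] (w T)) = C (algebraMap ℝ R (w T)) := rfl
  rw [h, derivative_C_mul, derivative_prod_finset]
  simp [eval_finsetSum, eval_prod, mul_sum]

/-- A homogeneous multi-affine polynomial of degree `m` with nonnegative coefficients `w` that has
no zeros in the product of the open right half-planes. -/
structure IsStableForm (m : ℕ) (w : Finset ι → ℝ) : Prop where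
  nonneg : ∀ T, 0 ≤ w T
  homog : ∀ T, w T ≠ 0 → T.card = m
  stable : ∀ z : ι → ℂ, (∀ i, 0 < (z i).re) → multiaffineEval w z ≠ 0

theorem IsStableForm.multiaffineEval_mul {m : ℕ} {w : Finset ι → ℝ} (hw : IsStableForm m w)
    {R : Type*} [CommRing R] [Algebra ℝ R] (c : R) (y : ι → R) :
    multiaffineEval w (fun i => c * y i) = c ^ m * multiaffineEval w y := by
  simp only [multiaffineEval, mul_sum]
  refine sum_congr rfl fun T _ => ?_
  by_cases h : w T = 0
  · simp [h]
  · rw [prod_mul_distrib, prod_const, hw.homog T h]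
    ring

theorem dirDeriv_nonneg [DecidableEq ι] {v : ι → ℝ} {w : Finset ι → ℝ} (hv : ∀ i, 0 ≤ v i) (hw : ∀ T, 0 ≤ w T)
    (T : Finset ι) : 0 ≤ dirDeriv v w T :=
  sum_nonneg fun i _ => mul_nonneg (hv i) (hw _)

theorem multiaffineEval_mono {w : Finset ι → ℝ} (hw : ∀ T, 0 ≤ w T) {x y : ι → ℝ}
    (hx : ∀ i, 0 ≤ x i) (hxy : ∀ i, x i ≤ y i) : multiaffineEval w x ≤ multiaffineEval w y := by
  refine sum_le_sum fun T _ => mul_le_mul_of_nonneg_left ?_ (by simpa using hw T)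
  exact prod_le_prod (fun i _ => hx i) fun i _ => hxy i

theorem multiaffineEval_mono_coeff {w w' : Finset ι → ℝ} (hw : ∀ T, w T ≤ w' T) {x : ι → ℝ}
    (hx : ∀ i, 0 ≤ x i) : multiaffineEval w x ≤ multiaffineEval w' x := by
  refine sum_le_sum fun T _ => mul_le_mul_of_nonneg_right (by simpa using hw T) ?_
  exact prod_nonneg fun i _ => hx i

theorem dirDeriv_mono [DecidableEq ι] {v v' : ι → ℝ} (h : ∀ i, v i ≤ v' i) {w : Finset ι → ℝ}
    (hw : ∀ T, 0 ≤ w T) (T : Finset ι) : dirDeriv v w T ≤ dirDeriv v' w T :=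
  sum_le_sum fun i _ => mul_le_mul_of_nonneg_right (h i) (hw _)

theorem continuous_multiaffineEval {R : Type*} [CommRing R] [Algebra ℝ R] [TopologicalSpace R]
    [IsTopologicalRing R] (w : Finset ι → ℝ) :
    Continuous (multiaffineEval w : (ι → R) → R) := by
  unfold multiaffineEval
  fun_prop

theorem IsStableForm.eval_pos {m : ℕ} {w : Finset ι → ℝ} (hw : IsStableForm m w) {y : ι → ℝ}
    (hy : ∀ i, 0 < y i) : 0 < multiaffineEval w y := by
  refine lt_of_le_of_ne (sum_nonneg fun T _ => mul_nonneg (hw.nonneg T)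
    (prod_nonneg fun i _ => (hy i).le)) fun h => ?_
  refine hw.stable (fun i => (y i : ℂ)) (by simpa using hy) ?_
  rw [multiaffineEval_ofReal, ← h, Complex.ofReal_zero]

/-- The derivative of a stable form in a positive direction is a stable form. -/
theorem IsStableForm.deriv [DecidableEq ι] {m : ℕ} {w : Finset ι → ℝ} (hw : IsStableForm (m + 1) w)
    {v : ι → ℝ} (hv : ∀ i, 0 < v i) : IsStableForm m (dirDeriv v w) where
  nonneg := dirDeriv_nonneg (fun i => (hv i).le) hw.nonneg
  homog T hT := by
    obtain ⟨i, hi, h⟩ := exists_ne_zero_of_sum_ne_zero hT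
    have := hw.homog _ (right_ne_zero_of_mul h)
    rw [card_insert_of_notMem (by simpa using hi)] at this
    omega
  stable z hz h0 := by
    rw [← eval_derivative_linePoly w z v] at h0
    set q := linePoly w z (fun i => algebraMap ℝ ℂ (v i)) with hq
    have hq0 : ∀ t : ℂ, 0 ≤ t.re → q.eval t ≠ 0 := by
      intro t ht
      rw [hq, eval_linePoly]
      refine hw.stable _ fun i => ?_
      have : 0 ≤ v i * t.re := mul_nonneg (hv i).le ht
      simpa using add_pos_of_pos_of_nonneg (hz i) this
    -- Gauss–Lucas: the roots of `q` have negative real part, hence so do those of `q'`, and 0 is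
    -- not one of them.
    by_cases hdeg : 0 < q.degree
    · have h1 : (0 : ℂ) ∈ q.derivative.rootSet ℂ := by
        rw [mem_rootSet]
        refine ⟨fun h => ?_, by simpa [Polynomial.coe_aeval_eq_eval] using h0⟩
        exact (natDegree_pos_iff_degree_pos.2 hdeg).ne' (derivative_eq_zero.1 h)
      have h2 := rootSet_derivative_subset_convexHull_rootSet hdeg h1
      have h3 : convexHull ℝ (q.rootSet ℂ) ⊆ {t : ℂ | t.re < 0} := by
        refine convexHull_min (fun t ht => ?_) (convex_halfSpace_re_lt 0)
        by_contra hcon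
        rw [mem_rootSet] at ht
        exact hq0 t (not_lt.1 hcon) (by simpa [Polynomial.coe_aeval_eq_eval] using ht.2)
      exact lt_irrefl (0 : ℝ) (by simpa using h3 h2)
    -- If `q` is constant, homogeneity reverses the line: the form at `v + t z` is `c t^(m+1)`. At
    -- `t = 0` it would vanish at the positive point `v`.
    · obtain ⟨c, hc⟩ : ∃ c, q = C c := ⟨_, eq_C_of_degree_le_zero (not_lt.1 hdeg)⟩
      have hr : linePoly w (fun i => algebraMap ℝ ℂ (v i)) z = C c * X ^ (m + 1) := by
        refine eq_of_infinite_eval_eq _ _ ((Set.finite_singleton (0 : ℂ)).infinite_compl.mono ?_)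
        intro t ht
        have ht : t ≠ 0 := ht
        have h1 := eval_linePoly w z (fun i => algebraMap ℝ ℂ (v i)) t⁻¹
        rw [← hq, hc, eval_C] at h1
        have h2 := hw.multiaffineEval_mul t (fun i => z i + algebraMap ℝ ℂ (v i) * t⁻¹)
        rw [← h1] at h2
        simp only [Set.mem_ofPred_eq, eval_linePoly, eval_mul, eval_C, eval_pow, eval_X]
        rw [mul_comm, ← h2]
        congr 1
        ext i
        field_simp
        ring
      have h4 := congrArg (eval 0) hr
      rw [eval_linePoly] at h4
      simp only [eval_mul, eval_C, eval_pow, eval_X, mul_zero, add_zero, ne_eq,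
        Nat.add_eq_zero_iff, one_ne_zero, and_false, not_false_eq_true, zero_pow] at h4
      exact hw.stable (fun i => algebraMap ℝ ℂ (v i)) (by simpa using hv) h4

/-- The restriction of a stable form to a line through a positive point in a nonnegative direction
has negative real roots only. -/
theorem IsStableForm.aeval_linePoly_ne_zero {m : ℕ} {w : Finset ι → ℝ} (hw : IsStableForm m w)
    {u v : ι → ℝ} (hu : ∀ i, 0 < u i) (hv : ∀ i, 0 ≤ v i) {t : ℂ}
    (ht : aeval t (linePoly w u v) = 0) : t.im = 0 ∧ t.re < 0 := by
  have h0 : multiaffineEval w (fun i => (u i : ℂ) + v i * t) = 0 := by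
    have := map_multiaffineEval ((Polynomial.aeval t : ℝ[X] →ₐ[ℝ] ℂ)) w
      (fun i => C (u i) + C (v i) * X)
    rw [linePoly] at ht
    rw [ht] at this
    simpa using this.symm
  by_contra hcon
  -- By homogeneity a zero may be multiplied by any `c`. Unless `t` is a negative real, some `c` in
  -- the right half-plane keeps `c * t` in the closed one; for nonreal `t` the choice below makes `c
  -- * t` purely imaginary.
  obtain ⟨c, hc, hct⟩ : ∃ c : ℂ, 0 < c.re ∧ 0 ≤ (c * t).re := by
    by_cases him : t.im = 0
    · exact ⟨1, by simp, by simpa using not_lt.1 fun h => hcon ⟨him, h⟩⟩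
    · refine ⟨⟨1, t.re / t.im⟩, by simp, ?_⟩
      simp [Complex.mul_re, him]
  refine hw.stable (fun i => c * (u i + v i * t)) (fun i => ?_) ?_
  · have h1 : c * (u i + v i * t) = (u i : ℂ) * c + (v i : ℂ) * (c * t) := by ring
    rw [h1, Complex.add_re, Complex.re_ofReal_mul, Complex.re_ofReal_mul]
    exact add_pos_of_pos_of_nonneg (mul_pos (hu i) hc) (mul_nonneg (hv i) hct)
  · rw [hw.multiaffineEval_mul, h0, mul_zero]

/-- Multi-affinity lets each coordinate contribute at most one power of `X`, and only where the
direction is nonzero. This is how column sparsity enters. -/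
theorem natDegree_linePoly_le (w : Finset ι → ℝ) (u v : ι → ℝ) :
    (linePoly w u v).natDegree ≤ (univ.filter fun i => v i ≠ 0).card := by
  refine natDegree_sum_le_of_forall_le _ _ fun T _ => ?_
  have h1 : ∀ i, (C (u i) + C (v i) * X).natDegree ≤ if v i ≠ 0 then 1 else 0 := fun i => by
    by_cases h : v i = 0
    · simp [h]
    · simp only [h, ne_eq, not_false_eq_true, if_true]
      rw [add_comm]
      exact natDegree_linear_le
  have h2 : (∏ i ∈ T, (C (u i) + C (v i) * X)).natDegree ≤ (univ.filter fun i => v i ≠ 0).card :=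
    calc (∏ i ∈ T, (C (u i) + C (v i) * X)).natDegree
        ≤ ∑ i ∈ T, (C (u i) + C (v i) * X).natDegree := natDegree_prod_le _ _
      _ ≤ ∑ i ∈ T, (if v i ≠ 0 then 1 else 0) := by
          gcongr with i
          exact h1 i
      _ ≤ ∑ i, (if v i ≠ 0 then 1 else 0) :=
          sum_le_sum_of_subset_of_nonneg (subset_univ _) fun _ _ _ => by positivity
      _ = _ := by rw [card_filter]
  exact (natDegree_C_mul_le _ _).trans h2

end StableForms

/-! ### Real-rooted polynomials: bounding the derivative at 0 from below. -/

section RealRooted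

open Polynomial

/-- The tangent inequality for `exp`, normalised to be sharp at `y = c - 1`. Multiplying copies of
it yields AM-GM without roots. -/
theorem one_add_le_mul_exp {c : ℝ} (hc : 0 < c) (y : ℝ) :
    1 + y ≤ c * Real.exp ((y - (c - 1)) / c) := by
  have h := Real.add_one_le_exp ((y - (c - 1)) / c)
  calc 1 + y = c * ((y - (c - 1)) / c + 1) := by field_simp; ring
    _ ≤ _ := mul_le_mul_of_nonneg_left h hc.le

/-- A form of the inequality between the arithmetic and the geometric mean. -/
theorem Multiset.prod_map_one_add_le {c : ℝ} (hc : 0 < c) (s : Multiset ℝ) (hs : ∀ a ∈ s, 0 ≤ a) :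
    (s.map (1 + ·)).prod ≤ c ^ s.card * Real.exp ((s.sum - s.card * (c - 1)) / c) := by
  induction s using Multiset.induction with
  | empty => simp
  | cons a s ih =>
    have ha : 0 ≤ a := hs a (Multiset.mem_cons_self a s)
    have h := ih fun b hb => hs b (Multiset.mem_cons_of_mem hb)
    rw [Multiset.map_cons, Multiset.prod_cons, Multiset.card_cons, Multiset.sum_cons]
    have h2 := one_add_le_mul_exp hc a
    calc (1 + a) * (s.map (1 + ·)).prod
        ≤ (c * Real.exp ((a - (c - 1)) / c)) *
          (c ^ s.card * Real.exp ((s.sum - s.card * (c - 1)) / c)) :=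
          mul_le_mul h2 h (Multiset.prod_nonneg fun x hx => by
            obtain ⟨b, hb, rfl⟩ := Multiset.mem_map.1 hx
            linarith [hs b (Multiset.mem_cons_of_mem hb)]) (by positivity)
      _ = c ^ (s.card + 1) * (Real.exp ((a - (c - 1)) / c) *
          Real.exp ((s.sum - s.card * (c - 1)) / c)) := by ring
      _ = _ := by
          rw [← Real.exp_add]
          congr 2
          push_cast
          field_simp
          ring

/-- If a polynomial `P` of degree at most `k` with negative real roots satisfies `C * t ≤ P t` for
all `t > 0`, then `P' 0` is at least `((k - 1) / k) ^ (k - 1) * C`. -/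
theorem le_derivative_of_forall_mul_le_eval {k : ℕ} (hk : 2 ≤ k) {P : ℝ[X]}
    (hdeg : P.natDegree ≤ k) (hroots : ∀ t : ℂ, aeval t P = 0 → t.im = 0 ∧ t.re < 0)
    (h0 : 0 < P.eval 0) {C : ℝ} (hC : ∀ t : ℝ, 0 < t → C * t ≤ P.eval t) :
    (((k : ℝ) - 1) / k) ^ (k - 1) * C ≤ P.derivative.eval 0 := by
  have hk1 : (0 : ℝ) < (k : ℝ) - 1 := by
    have : (2 : ℝ) ≤ k := by exact_mod_cast hk
    linarith
  have hk0 : (0 : ℝ) < k := by linarith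
  have hP0 : P ≠ 0 := by rintro rfl; simp at h0
  have hsp : P.Splits := by
    refine Splits.of_splits_map (algebraMap ℝ ℂ) (IsAlgClosed.splits _) fun a ha => ⟨a.re, ?_⟩
    rw [mem_roots (map_ne_zero hP0), IsRoot.def, eval_map_algebraMap] at ha
    exact Complex.ext (by simp) (by simp [(hroots a ha).1])
  have hneg : ∀ r ∈ P.roots, r < 0 := by
    intro r hr
    rw [mem_roots hP0, IsRoot.def] at hr
    have := (hroots (r : ℂ) (by
      rw [← Complex.coe_algebraMap, aeval_algebraMap_apply, coe_aeval_eq_eval, hr]; simp)).2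
    simpa using this
  -- With these `a = -1/r > 0`, `P t = P 0 * ∏ (1 + a t)` and `P' 0 = P 0 * ∑ a`.
  set s : Multiset ℝ := P.roots.map fun r => 1 / (0 - r) with hs
  have hspos : ∀ a ∈ s, 0 < a := by
    intro a ha
    obtain ⟨r, hr, rfl⟩ := Multiset.mem_map.1 ha
    have := hneg r hr
    exact one_div_pos.2 (by linarith)
  have hder : P.derivative.eval 0 = P.eval 0 * s.sum :=
    hsp.eval_derivative_eq_eval_mul_sum h0.ne'
  have heval : ∀ t, P.eval t = P.eval 0 * ((s.map (· * t)).map (1 + ·)).prod := by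
    intro t
    rw [hsp.eval_eq_prod_roots t, hsp.eval_eq_prod_roots 0, hs, Multiset.map_map,
      Multiset.map_map, mul_assoc, ← Multiset.prod_map_mul]
    congr 2
    refine Multiset.map_congr rfl fun r hr => ?_
    have : (0 - r) ≠ 0 := by have := hneg r hr; intro h; linarith
    simp only [Function.comp]
    field_simp
    ring
  have hsum : 0 ≤ s.sum := Multiset.sum_nonneg fun a ha => (hspos a ha).le
  rcases le_or_gt C 0 with hC0 | hC0
  · rw [hder]
    exact (mul_nonpos_of_nonneg_of_nonpos (by positivity) hC0).trans (mul_nonneg h0.le hsum)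
  -- A zero sum means no roots, so `P` is constant and cannot dominate `C * t` for large `t`.
  have hsum : 0 < s.sum := by
    refine lt_of_le_of_ne hsum fun h => ?_
    have hs0 : s = 0 := by
      by_contra hne
      obtain ⟨a, ha⟩ := Multiset.exists_mem_of_ne_zero hne
      have := Multiset.single_le_sum (fun b hb => (hspos b hb).le) a ha
      linarith [hspos a ha]
    have h1 := hC ((P.eval 0 + 1) / C) (by positivity)
    rw [heval (_ / C), hs0, mul_div_cancel₀ _ hC0.ne'] at h1
    simp only [Multiset.map_zero, Multiset.prod_zero, mul_one] at h1
    linarith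
  -- The point `t = c / s.sum` minimises `(1 + t * s.sum / k)^k / t`, and there the base equals `c`.
  set c : ℝ := k / (k - 1) with hc
  have hc0 : 0 < c := by positivity
  have hcard : s.card ≤ k := by
    rw [hs, Multiset.card_map]
    exact (card_roots' P).trans hdeg
  have ht : 0 < c / s.sum := by positivity
  -- Padding with zeros to exactly `k` entries leaves product and sum unchanged and makes the
  -- exponent in AM-GM vanish.
  have hb := Multiset.prod_map_one_add_le hc0 (s.map (· * (c / s.sum)) +
    Multiset.replicate (k - s.card) 0) (by
      intro a ha
      rcases Multiset.mem_add.1 ha with ha | ha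
      · obtain ⟨b, hb, rfl⟩ := Multiset.mem_map.1 ha
        exact mul_nonneg (hspos b hb).le ht.le
      · exact (Multiset.eq_of_mem_replicate ha).ge)
  have hcardk : (s.map (· * (c / s.sum)) + Multiset.replicate (k - s.card) (0 : ℝ)).card = k := by
    simp; omega
  rw [hcardk] at hb
  have hsumc : (s.map (· * (c / s.sum)) + Multiset.replicate (k - s.card) (0 : ℝ)).sum = c := by
    rw [Multiset.sum_add, Multiset.sum_map_mul_right, Multiset.map_id', Multiset.sum_replicate]
    field_simp
    simp
  have hexp : (c - k * (c - 1)) / c = 0 := by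
    rw [hc]; field_simp; ring
  rw [hsumc, hexp, Real.exp_zero, mul_one, Multiset.map_add, Multiset.prod_add,
    Multiset.map_replicate, Multiset.prod_replicate, add_zero, one_pow, mul_one] at hb
  have h1 := (hC _ ht).trans_eq (heval _)
  have h2 : C * (c / s.sum) ≤ P.eval 0 * c ^ k := h1.trans (mul_le_mul_of_nonneg_left hb h0.le)
  have h3 : c ^ k = c ^ (k - 1) * c := by rw [← pow_succ]; congr 1; omega
  have h4 : (((k : ℝ) - 1) / k) ^ (k - 1) = (c ^ (k - 1))⁻¹ := by
    rw [← inv_pow, hc, inv_div]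
  rw [h4, inv_mul_le_iff₀ (by positivity), hder]
  rw [h3, mul_div_assoc', div_le_iff₀ hsum] at h2
  have h5 : C * c ≤ (c ^ (k - 1) * (P.eval 0 * s.sum)) * c := by linarith
  exact le_of_mul_le_mul_right h5 hc0

end RealRooted

/-! ### Capacity and the permanent. -/

section Capacity

open Polynomial Finset Filter Topology

variable {ι : Type*} [Fintype ι] [DecidableEq ι]

theorem IsStableForm.mul_le_multiaffineEval_dirDeriv_of_pos {k m : ℕ} (hk : 2 ≤ k)
    {w : Finset ι → ℝ} (hw : IsStableForm m w) {u v : ι → ℝ} (hu : ∀ i, 0 < u i)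
    (hv : ∀ i, 0 ≤ v i) (hcard : (univ.filter fun i => v i ≠ 0).card ≤ k) {C : ℝ}
    (hC : ∀ t : ℝ, 0 < t → C * t ≤ multiaffineEval w fun i => u i + v i * t) :
    (((k : ℝ) - 1) / k) ^ (k - 1) * C ≤ multiaffineEval (dirDeriv v w) u := by
  have h := le_derivative_of_forall_mul_le_eval hk ((natDegree_linePoly_le w u v).trans hcard)
    (fun t ht => hw.aeval_linePoly_ne_zero hu hv ht)
    (by rw [eval_linePoly]; simpa using hw.eval_pos hu) (C := C)
    (fun t ht => by rw [eval_linePoly]; exact hC t ht)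
  exact h.trans_eq (eval_derivative_linePoly w u v)

/-- Shifting `u` by `δ > 0` makes it positive and, by monotonicity, preserves the capacity bound;
then `δ → 0`. -/
theorem IsStableForm.mul_le_multiaffineEval_dirDeriv {k m : ℕ} (hk : 2 ≤ k)
    {w : Finset ι → ℝ} (hw : IsStableForm m w) {u v : ι → ℝ} (hu : ∀ i, 0 ≤ u i)
    (hv : ∀ i, 0 ≤ v i) (hcard : (univ.filter fun i => v i ≠ 0).card ≤ k) {C : ℝ}
    (hC : ∀ t : ℝ, 0 < t → C * t ≤ multiaffineEval w fun i => u i + v i * t) :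
    (((k : ℝ) - 1) / k) ^ (k - 1) * C ≤ multiaffineEval (dirDeriv v w) u := by
  have hlim : Tendsto (fun δ : ℝ => multiaffineEval (dirDeriv v w) fun i => u i + δ)
      (𝓝[>] 0) (𝓝 (multiaffineEval (dirDeriv v w) u)) := by
    have hcont : Continuous fun δ : ℝ => multiaffineEval (dirDeriv v w) fun i => u i + δ :=
      (continuous_multiaffineEval _).comp (by fun_prop)
    have := hcont.tendsto 0
    simp only [add_zero] at this
    exact this.mono_left nhdsWithin_le_nhds
  refine ge_of_tendsto hlim ?_
  filter_upwards [self_mem_nhdsWithin] with δ hδ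
  have hδ : 0 < δ := hδ
  refine hw.mul_le_multiaffineEval_dirDeriv_of_pos hk
    (fun i => add_pos_of_nonneg_of_pos (hu i) hδ) hv hcard fun t ht => (hC t ht).trans ?_
  refine multiaffineEval_mono hw.nonneg
    (fun i => add_nonneg (hu i) (mul_nonneg (hv i) ht.le)) fun i => by linarith

/-- The constant obtained by differentiating a multi-affine form in the directions
`c (r - 1), …, c 0`. -/
def iterDirDeriv (c : ℕ → ι → ℝ) : ℕ → (Finset ι → ℝ) → ℝ
  | 0, w => w ∅
  | r + 1, w => iterDirDeriv c r (dirDeriv (c r) w)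

theorem IsStableForm.multiaffineEval_eq_dirDeriv {w : Finset ι → ℝ} (hw : IsStableForm 1 w)
    (y : ι → ℝ) : multiaffineEval w y = dirDeriv y w ∅ := by
  have h1 : multiaffineEval w y = ∑ T ∈ powersetCard 1 univ, w T * ∏ i ∈ T, y i := by
    refine (sum_subset (subset_univ _) fun T _ hT => ?_).symm
    have : w T = 0 := by
      by_contra h
      exact hT (mem_powersetCard.2 ⟨subset_univ _, hw.homog T h⟩)
    simp [this]
  rw [h1, powersetCard_one, sum_map]
  simp [dirDeriv, mul_comm]

/-- Two families are needed: `c` carries the sparsity and the capacity bound, while derivatives are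
taken along the strictly positive `c'`, so that stability persists. Each induction step removes one
variable and replaces `K` by `g * K`. -/
theorem le_iterDirDeriv {k : ℕ} (hk : 2 ≤ k) {c c' : ℕ → ι → ℝ} (hc : ∀ j i, 0 ≤ c j i)
    (hcc' : ∀ j i, c j i ≤ c' j i) (hc' : ∀ j i, 0 < c' j i)
    (hcard : ∀ j, (univ.filter fun i => c j i ≠ 0).card ≤ k) (r : ℕ) :
    ∀ (w : Finset ι → ℝ) (K : ℝ), IsStableForm (r + 1) w →
      (∀ x : ℕ → ℝ, (∀ j, 0 < x j) → K * ∏ j ∈ range (r + 1), x j ≤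
        multiaffineEval w fun i => ∑ j ∈ range (r + 1), c j i * x j) →
      ((((k : ℝ) - 1) / k) ^ (k - 1)) ^ r * K ≤ iterDirDeriv c' (r + 1) w := by
  induction r with
  | zero =>
    -- A linear form is its own derivative in the direction of evaluation, so the last variable
    -- costs no factor.
    intro w K hw hK
    have h := hK (fun _ => 1) fun _ => one_pos
    simp only [zero_add, range_one, sum_singleton, prod_singleton, mul_one] at h
    rw [pow_zero, one_mul]
    rw [zero_add] at hw
    rw [hw.multiaffineEval_eq_dirDeriv] at h
    exact h.trans (dirDeriv_mono (hcc' 0) hw.nonneg ∅)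
  | succ r ih =>
    intro w K hw hK
    rw [iterDirDeriv, pow_succ, mul_assoc]
    refine ih _ _ (hw.deriv (hc' (r + 1))) fun x hx => ?_
    have hu : ∀ i, 0 ≤ ∑ j ∈ range (r + 1), c j i * x j := fun i =>
      sum_nonneg fun j _ => mul_nonneg (hc j i) (hx j).le
    have h := hw.mul_le_multiaffineEval_dirDeriv hk hu (hc (r + 1)) (hcard (r + 1))
      (C := K * ∏ j ∈ range (r + 1), x j) fun t ht => by
        -- Only the last variable moves, so the capacity bound becomes linear in `t`.
        have h1 := hK (Function.update x (r + 1) t) fun j => by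
          by_cases hj : j = r + 1
          · subst hj; simpa using ht
          · simpa [hj] using hx j
        rw [prod_range_succ] at h1
        simp only [sum_range_succ _ (r + 1), Function.update_self] at h1
        have h2 : ∏ j ∈ range (r + 1), Function.update x (r + 1) t j =
            ∏ j ∈ range (r + 1), x j := prod_congr rfl fun j hj => by
          rw [Function.update_of_ne (mem_range.1 hj).ne]
        have h3 : ∀ i, ∑ j ∈ range (r + 1), c j i * Function.update x (r + 1) t j =
            ∑ j ∈ range (r + 1), c j i * x j := fun i => sum_congr rfl fun j hj => by
          rw [Function.update_of_ne (mem_range.1 hj).ne]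
        simp only [h2, h3] at h1
        rwa [mul_assoc]
    rw [mul_assoc]
    exact h.trans (multiaffineEval_mono_coeff (dirDeriv_mono (hcc' (r + 1)) hw.nonneg) hu)

open Classical in
-- Here `f j` is the variable removed by the derivative along `c j`; none can be removed twice,
-- whence injectivity.
theorem iterDirDeriv_eq_sum (c : ℕ → ι → ℝ) (r : ℕ) : ∀ w : Finset ι → ℝ,
    iterDirDeriv c r w = ∑ f : Fin r → ι,
      if Function.Injective f then (∏ j : Fin r, c j (f j)) * w (univ.image f) else 0 := by
  induction r with
  | zero =>
    intro w
    simp [iterDirDeriv, Function.injective_of_subsingleton]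
  | succ r ih =>
    intro w
    rw [iterDirDeriv, ih, ← (Fin.snocEquiv fun _ => ι).sum_comp, Fintype.sum_prod_type_right]
    refine sum_congr rfl fun f _ => ?_
    have himage : ∀ i, univ.image (Fin.snoc f i : Fin (r + 1) → ι) = insert i (univ.image f) := by
      intro i
      ext a
      simp [Fin.exists_fin_succ', or_comm, eq_comm]
    have hsnoc : ∀ i, (Fin.snocEquiv fun _ => ι) (i, f) = (Fin.snoc f i : Fin (r + 1) → ι) :=
      fun _ => rfl
    by_cases hf : Function.Injective f
    · rw [if_pos hf, dirDeriv, mul_sum]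
      rw [← sum_subset (subset_univ (univ.image f)ᶜ)]
      · refine sum_congr rfl fun i hi => ?_
        have hi' : i ∉ Set.range f := by simpa using hi
        simp only [hsnoc]
        rw [if_pos (Fin.snoc_injective_iff.2 ⟨hf, hi'⟩), Fin.prod_univ_castSucc, himage]
        simp [mul_assoc]
      · intro i _ hi
        have hi' : i ∈ Set.range f := by simpa using hi
        simp only [hsnoc]
        rw [if_neg fun h => (Fin.snoc_injective_iff.1 h).2 hi']
    · rw [if_neg hf]
      refine (sum_eq_zero fun i _ => ?_).symm
      simp only [hsnoc]
      rw [if_neg fun h => hf (Fin.snoc_injective_iff.1 h).1]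

/-- The coefficients of the product of all variables. -/
def prodForm (T : Finset ι) : ℝ := if T = univ then 1 else 0

theorem multiaffineEval_prodForm {R : Type*} [CommRing R] [Algebra ℝ R] (y : ι → R) :
    multiaffineEval prodForm y = ∏ i, y i := by
  simp [multiaffineEval, prodForm, apply_ite (algebraMap ℝ R)]

theorem isStableForm_prodForm : IsStableForm (Fintype.card ι) (prodForm : Finset ι → ℝ) where
  nonneg T := by unfold prodForm; split_ifs <;> norm_num
  homog T hT := by
    have : T = univ := by
      by_contra h
      exact hT (if_neg h)
    rw [this, card_univ]
  stable z hz := by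
    rw [multiaffineEval_prodForm]
    refine prod_ne_zero_iff.2 fun i _ h => ?_
    simpa [h] using hz i

theorem iterDirDeriv_prodForm {n : ℕ} (c : ℕ → Fin n → ℝ) :
    iterDirDeriv c n prodForm = Matrix.permanent (Matrix.of fun i j : Fin n => c j i) := by
  classical
  rw [iterDirDeriv_eq_sum, ← sum_filter, Matrix.permanent]
  refine (sum_bij (fun (σ : Equiv.Perm (Fin n)) _ => (σ : Fin n → Fin n)) ?_ ?_ ?_ ?_).symm
  · intro σ _
    simpa using σ.injective
  · intro σ _ τ _ h
    exact DFunLike.coe_injective h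
  · intro f hf
    exact ⟨Equiv.ofBijective f (Finite.injective_iff_bijective.1 (by simpa using hf)),
      mem_univ _, rfl⟩
  · intro σ _
    have : univ.image (σ : Fin n → Fin n) = univ := image_univ_of_surjective σ.surjective
    simp [prodForm, this]

/-- Gurvits' capacity bound for the permanent, for a matrix whose columns have at most `k` nonzero
entries. -/
theorem capacity_le_permanent {k r : ℕ} (hk : 2 ≤ k)
    {A : Matrix (Fin (r + 1)) (Fin (r + 1)) ℝ} (hA : ∀ i j, 0 ≤ A i j)
    (hcard : ∀ j, (univ.filter fun i => A i j ≠ 0).card ≤ k) {K : ℝ}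
    (hK : ∀ x : Fin (r + 1) → ℝ, (∀ j, 0 < x j) → K * ∏ j, x j ≤ ∏ i, ∑ j, A i j * x j) :
    ((((k : ℝ) - 1) / k) ^ (k - 1)) ^ r * K ≤ A.permanent := by
  -- Adding `ε` to every entry supplies the strictly positive directions; the permanent is
  -- continuous in `ε`.
  have hlim : Tendsto (fun ε : ℝ => (Matrix.of fun i j => A i j + ε).permanent) (𝓝[>] 0)
      (𝓝 A.permanent) := by
    have hcont : Continuous fun ε : ℝ => (Matrix.of fun i j => A i j + ε).permanent := by
      simp only [Matrix.permanent, Matrix.of_apply]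
      fun_prop
    have := hcont.tendsto 0
    simp only [add_zero] at this
    exact this.mono_left nhdsWithin_le_nhds
  refine ge_of_tendsto hlim ?_
  filter_upwards [self_mem_nhdsWithin] with ε hε
  have hε : 0 < ε := hε
  -- Indices beyond `r` wrap around to genuine columns, so nonnegativity and sparsity hold for every
  -- natural `j`.
  set c : ℕ → Fin (r + 1) → ℝ := fun j i => A i (Fin.ofNat (r + 1) j) with hc
  have hcj : ∀ (j i : Fin (r + 1)), c j i = A i j := fun j i => by simp [hc]
  have h := le_iterDirDeriv hk (c := c) (c' := fun j i => c j i + ε)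
    (fun j i => hA _ _) (fun j i => by linarith)
    (fun j i => add_pos_of_nonneg_of_pos (hA _ _) hε) (fun j => hcard _) r prodForm K
    (by simpa using isStableForm_prodForm (ι := Fin (r + 1))) fun x hx => by
      rw [multiaffineEval_prodForm]
      simp only [prod_range, sum_range, hcj]
      exact hK (fun j => x j) fun j => hx j
  rw [iterDirDeriv_prodForm] at h
  simpa only [hcj] using h

end Capacity

/-! ### Regular 0-1 matrices: Schrijver's bound and the Bethe permanent. -/

section Bethe

open Finset

theorem schrijverBound_eq {k : ℕ} (hk : 2 ≤ k) (n : ℕ) :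
    schrijverBound k n = (k * (((k : ℝ) - 1) / k) ^ (k - 1)) ^ n := by
  obtain ⟨m, rfl⟩ := Nat.exists_eq_add_of_le' hk
  have h : ((m + 2 : ℕ) : ℝ) ≠ 0 := by positivity
  have h1 : m + 2 - 1 = m + 1 := rfl
  rw [schrijverBound, h1, Nat.add_sub_cancel]
  congr 1
  rw [div_pow, pow_succ ((m + 2 : ℕ) : ℝ) m]
  field_simp

/-- A `0`-`1` matrix all of whose row and column sums are `k`. -/
structure IsRegularZeroOne {n : ℕ} (k : ℕ) (A : Matrix (Fin n) (Fin n) ℝ) : Prop where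
  zero_or_one : ∀ i j, A i j = 0 ∨ A i j = 1
  row_sum : ∀ i, ∑ j, A i j = k
  col_sum : ∀ j, ∑ i, A i j = k

theorem IsRegularZeroOne.nonneg {n k : ℕ} {A : Matrix (Fin n) (Fin n) ℝ}
    (hA : IsRegularZeroOne k A) (i j : Fin n) : 0 ≤ A i j := by
  rcases hA.zero_or_one i j with h | h <;> simp [h]

theorem IsRegularZeroOne.transpose {n k : ℕ} {A : Matrix (Fin n) (Fin n) ℝ}
    (hA : IsRegularZeroOne k A) : IsRegularZeroOne k A.transpose :=
  ⟨fun i j => hA.zero_or_one j i, hA.col_sum, hA.row_sum⟩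

theorem IsRegularZeroOne.card_row {n k : ℕ} {A : Matrix (Fin n) (Fin n) ℝ}
    (hA : IsRegularZeroOne k A) (i : Fin n) : (univ.filter fun j => A i j ≠ 0).card = k := by
  have h : ((univ.filter fun j => A i j ≠ 0).card : ℝ) = k := by
    rw [← hA.row_sum i, card_filter, Nat.cast_sum]
    refine sum_congr rfl fun j _ => ?_
    rcases hA.zero_or_one i j with h | h <;> simp [h]
  exact_mod_cast h

/-- The capacity estimate: weighted AM-GM in each row with weights `A i j / k`. In the product over
rows, the column sums give every `x j` total exponent 1. -/
theorem IsRegularZeroOne.mul_prod_le {n k : ℕ} (hk : 0 < k) {A : Matrix (Fin n) (Fin n) ℝ}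
    (hA : IsRegularZeroOne k A) {x : Fin n → ℝ} (hx : ∀ j, 0 < x j) :
    (k : ℝ) ^ n * ∏ j, x j ≤ ∏ i, ∑ j, A i j * x j := by
  have hk0 : (0 : ℝ) < k := by exact_mod_cast hk
  have hrow : ∀ i, (k : ℝ) * ∏ j, x j ^ (A i j / k) ≤ ∑ j, A i j * x j := by
    intro i
    have h := Real.geom_mean_le_arith_mean_weighted univ (fun j => A i j / k) x
      (fun j _ => div_nonneg (hA.nonneg i j) hk0.le)
      (by rw [← sum_div, hA.row_sum, div_self hk0.ne']) (fun j _ => (hx j).le)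
    calc (k : ℝ) * ∏ j, x j ^ (A i j / k) ≤ k * ∑ j, A i j / k * x j :=
          mul_le_mul_of_nonneg_left h hk0.le
      _ = ∑ j, A i j * x j := by
          rw [mul_sum]
          refine sum_congr rfl fun j _ => ?_
          field_simp
  calc (k : ℝ) ^ n * ∏ j, x j = ∏ i : Fin n, ((k : ℝ) * ∏ j, x j ^ (A i j / k)) := by
        rw [prod_mul_distrib, prod_const, card_univ, Fintype.card_fin, prod_comm]
        congr 1
        refine prod_congr rfl fun j _ => ?_
        rw [← Real.rpow_sum_of_pos (hx j), ← sum_div, hA.col_sum, div_self hk0.ne', Real.rpow_one]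
    _ ≤ _ := prod_le_prod (fun i _ => mul_nonneg hk0.le (prod_nonneg fun j _ =>
        Real.rpow_nonneg (hx j).le _)) fun i _ => hrow i

/-- Schrijver's bound, in a strict form. -/
theorem IsRegularZeroOne.schrijverBound_lt_permanent {n k : ℕ} (hk : 2 ≤ k) (hn : 1 ≤ n)
    {A : Matrix (Fin n) (Fin n) ℝ} (hA : IsRegularZeroOne k A) :
    schrijverBound k n < A.permanent := by
  obtain ⟨r, rfl⟩ := Nat.exists_eq_add_of_le' hn
  have h := capacity_le_permanent hk hA.nonneg (fun j => (hA.transpose.card_row j).le)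
    (fun x hx => hA.mul_prod_le (by omega) hx)
  refine lt_of_lt_of_le ?_ h
  have hk2 : (2 : ℝ) ≤ k := by exact_mod_cast hk
  have hk0 : (0 : ℝ) < k := by linarith
  set g : ℝ := (((k : ℝ) - 1) / k) ^ (k - 1) with hg
  have hg0 : 0 < g := pow_pos (div_pos (by linarith) hk0) _
  have hg1 : g < 1 :=
    pow_lt_one₀ (div_nonneg (by linarith) hk0.le) ((div_lt_one hk0).2 (by linarith)) (by omega)
  rw [schrijverBound_eq hk, ← hg]
  -- The capacity bound has only `r = n - 1` factors `g`; the missing one, `g < 1`, gives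
  -- strictness.
  calc (k * g) ^ (r + 1) = g ^ r * (k : ℝ) ^ (r + 1) * g := by ring
    _ < g ^ r * (k : ℝ) ^ (r + 1) * 1 := by
        refine mul_lt_mul_of_pos_left hg1 (by positivity)
    _ = _ := mul_one _

theorem prod_le_mean_pow {α : Type*} {s : Finset α} (hs : s.Nonempty) {x : α → ℝ}
    (hx : ∀ i ∈ s, 0 ≤ x i) : ∏ i ∈ s, x i ≤ ((∑ i ∈ s, x i) / s.card) ^ s.card := by
  have hc : (0 : ℝ) < s.card := by exact_mod_cast hs.card_pos
  have h := Real.geom_mean_le_arith_mean_weighted s (fun _ => (s.card : ℝ)⁻¹) x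
    (fun _ _ => by positivity) (by simp [hc.ne']) hx
  have h2 := pow_le_pow_left₀ (prod_nonneg fun i hi => Real.rpow_nonneg (hx i hi) _) h s.card
  rw [← prod_pow, ← mul_sum, inv_mul_eq_div] at h2
  refine le_trans (le_of_eq (prod_congr rfl fun i hi => ?_)) h2
  rw [Real.rpow_inv_natCast_pow (hx i hi) hs.card_pos.ne']

/-- Maclaurin's inequality for the elementary symmetric polynomial of degree `card s - 1`. -/
theorem sum_prod_erase_le {α : Type*} [DecidableEq α] (s : Finset α) {x : α → ℝ}
    (hx : ∀ i ∈ s, 0 ≤ x i) :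
    ∑ i ∈ s, ∏ j ∈ s.erase i, x j ≤ s.card * ((∑ i ∈ s, x i) / s.card) ^ (s.card - 1) := by
  induction s using Finset.induction_on with
  | empty => simp
  | insert a s ha ih =>
    have hxa : 0 ≤ x a := hx a (mem_insert_self a s)
    have hxs : ∀ i ∈ s, 0 ≤ x i := fun i hi => hx i (mem_insert_of_mem hi)
    rcases s.eq_empty_or_nonempty with rfl | hs
    · simp
    have h1 : ∑ i ∈ insert a s, ∏ j ∈ (insert a s).erase i, x j =
        ∏ i ∈ s, x i + x a * ∑ i ∈ s, ∏ j ∈ s.erase i, x j := by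
      rw [sum_insert ha, erase_insert ha, mul_sum]
      congr 1
      refine sum_congr rfl fun i hi => ?_
      have hne : a ≠ i := fun h => ha (h ▸ hi)
      rw [erase_insert_of_ne hne, prod_insert fun h => ha (mem_of_mem_erase h)]
    have hd : 0 < s.card := hs.card_pos
    have hd' : (0 : ℝ) < s.card := by exact_mod_cast hd
    rw [h1, sum_insert ha, card_insert_of_notMem ha, Nat.add_sub_cancel]
    set σ : ℝ := (∑ i ∈ s, x i) / s.card with hσ
    have hσ0 : 0 ≤ σ := div_nonneg (sum_nonneg hxs) hd'.le
    have hsum : ∑ i ∈ s, x i = s.card * σ := by rw [hσ]; field_simp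
    rw [hsum]
    have h2 := prod_le_mean_pow hs hxs
    have h3 := mul_le_mul_of_nonneg_left (ih hxs) hxa
    refine (add_le_add h2 h3).trans ?_
    rw [← hσ]
    generalize s.card = d at hd hd'
    obtain ⟨e, rfl⟩ := Nat.exists_eq_add_of_le' hd
    rw [Nat.add_sub_cancel]
    push_cast at hd' ⊢
    rcases hσ0.eq_or_lt with h0 | hpos
    · rw [← h0]
      rcases Nat.eq_zero_or_pos e with rfl | he
      · norm_num
        linarith
      · rw [zero_pow he.ne', zero_pow (by omega)]
        have : 0 ≤ ((e : ℝ) + 1 + 1) * ((x a + (e + 1) * 0) / (e + 1 + 1)) ^ (e + 1) := by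
          positivity
        linarith
    -- After division by `σ^(e+1)` the claim is exactly Bernoulli's inequality for this increment,
    -- the relative change of the mean when `a` joins `s`.
    · have hb := one_add_mul_le_pow (a := (x a / σ - 1) / (e + 1 + 1)) (by
        rw [le_div_iff₀ (by positivity)]
        have : 0 ≤ x a / σ := by positivity
        nlinarith [Nat.cast_nonneg (α := ℝ) e]) (e + 1)
      have h4 : (x a + (e + 1) * σ) / (e + 1 + 1) = σ * (1 + (x a / σ - 1) / (e + 1 + 1)) := by
        field_simp
        ring
      rw [h4, mul_pow]
      have h5 := mul_le_mul_of_nonneg_left hb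
        (show 0 ≤ ((e : ℝ) + 1 + 1) * σ ^ (e + 1) by positivity)
      refine le_trans (le_of_eq ?_) (h5.trans_eq (by ring))
      push_cast
      rw [pow_succ]
      field_simp
      ring

/-- The contribution of one row to the Bethe functional is maximal at the uniform distribution. -/
theorem sum_bethe_row_le {α : Type*} [DecidableEq α] {s : Finset α} (hs : 2 ≤ s.card) {q : α → ℝ}
    (hq : ∀ i ∈ s, 0 ≤ q i) (hsum : ∑ i ∈ s, q i = 1) :
    ∑ i ∈ s, ((1 - q i) * Real.log (1 - q i) - q i * Real.log (q i)) ≤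
      Real.log (s.card * (((s.card : ℝ) - 1) / s.card) ^ (s.card - 1)) := by
  have hk2 : (2 : ℝ) ≤ s.card := by exact_mod_cast hs
  set M : ℝ := s.card * (((s.card : ℝ) - 1) / s.card) ^ (s.card - 1) with hM
  have hM0 : 0 < M := mul_pos (by linarith) (pow_pos (div_pos (by linarith) (by linarith)) _)
  have hq1 : ∀ i ∈ s, q i ≤ 1 := fun i hi => hsum ▸ single_le_sum hq hi
  have hmac : ∑ i ∈ s, ∏ j ∈ s.erase i, (1 - q j) ≤ M := by
    have h := sum_prod_erase_le s (x := fun i => 1 - q i) fun i hi => by linarith [hq1 i hi]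
    rwa [sum_sub_distrib, hsum, sum_const, nsmul_eq_mul, mul_one] at h
  -- Writing `1 - q i` as the sum of the other `q j` and exchanging sums turns the row into `∑ q i *
  -- log (w i / q i)`, with `w i = ∏ (1 - q j)` over `j ≠ i`. Gibbs' inequality bounds this by `log
  -- (∑ w i)`, and `hmac` bounds `∑ w i` by `M`.
  have hexpand : ∑ i ∈ s, (1 - q i) * Real.log (1 - q i) =
      ∑ i ∈ s, q i * ∑ j ∈ s.erase i, Real.log (1 - q j) := by
    have h1 : ∀ i ∈ s, 1 - q i = ∑ j ∈ s.erase i, q j := fun i hi => by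
      rw [← hsum, ← add_sum_erase s q hi, add_sub_cancel_left]
    rw [sum_congr rfl fun i hi => by
      rw [show (1 - q i) * Real.log (1 - q i) = (∑ j ∈ s.erase i, q j) * Real.log (1 - q i) by
        rw [← h1 i hi]]]
    simp only [mul_sum, sum_mul]
    refine sum_comm' fun i j => ?_
    simp only [mem_erase]
    tauto
  rw [sum_sub_distrib, hexpand, ← sum_sub_distrib]
  -- Gibbs' inequality termwise, from `log x ≤ x - 1` at `x = w i / (q i * M)`. The case `q i = 0`
  -- is separate; if `q i > 0`, all other `1 - q j` are positive.
  have hterm : ∀ i ∈ s, q i * ∑ j ∈ s.erase i, Real.log (1 - q j) - q i * Real.log (q i) ≤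
      q i * Real.log M + ((∏ j ∈ s.erase i, (1 - q j)) / M - q i) := by
    intro i hi
    rcases (hq i hi).eq_or_lt with h0 | hpos
    · rw [← h0]
      have : 0 ≤ ∏ j ∈ s.erase i, (1 - q j) :=
        prod_nonneg fun j hj => by linarith [hq1 j (mem_of_mem_erase hj)]
      have := div_nonneg this hM0.le
      simpa using this
    · have hlt : ∀ j ∈ s.erase i, 0 < 1 - q j := by
        intro j hj
        have h1 := add_sum_erase s q hi
        have h2 : q j ≤ ∑ l ∈ s.erase i, q l :=
          single_le_sum (fun l hl => hq l (mem_of_mem_erase hl)) hj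
        linarith
      set w := ∏ j ∈ s.erase i, (1 - q j) with hw
      have hw0 : 0 < w := prod_pos hlt
      rw [← Real.log_prod fun j hj => (hlt j hj).ne', ← hw]
      have h := Real.log_le_sub_one_of_pos (show 0 < w / (q i * M) by positivity)
      rw [Real.log_div hw0.ne' (by positivity), Real.log_mul hpos.ne' hM0.ne'] at h
      have h2 := mul_le_mul_of_nonneg_left h hpos.le
      have h3 : q i * (w / (q i * M) - 1) = w / M - q i := by field_simp
      rw [h3] at h2
      linarith
  refine (sum_le_sum hterm).trans ?_
  rw [sum_add_distrib, ← sum_mul, hsum, sum_sub_distrib, hsum, ← sum_div]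
  have := (div_le_one hM0).2 hmac
  linarith

theorem IsRegularZeroOne.betheCW_eq {n k : ℕ} {A Q : Matrix (Fin n) (Fin n) ℝ}
    (hA : IsRegularZeroOne k A) (hQ : ∀ i j, A i j = 0 → Q i j = 0) :
    betheCW A Q = ∑ i, ∑ j ∈ univ.filter fun j => A i j ≠ 0,
      ((1 - Q i j) * Real.log (1 - Q i j) - Q i j * Real.log (Q i j)) := by
  refine sum_congr rfl fun i _ => ?_
  rw [sum_filter]
  refine sum_congr rfl fun j _ => ?_
  rcases hA.zero_or_one i j with h | h
  · simp [h, hQ i j h]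
  · simp [h]

theorem IsRegularZeroOne.betheCW_le {n k : ℕ} (hk : 2 ≤ k) {A Q : Matrix (Fin n) (Fin n) ℝ}
    (hA : IsRegularZeroOne k A) (hQ : Q ∈ betheDomain A) :
    betheCW A Q ≤ n * Real.log (k * (((k : ℝ) - 1) / k) ^ (k - 1)) := by
  rw [hA.betheCW_eq hQ.2]
  have hrow := (mem_doublyStochastic_iff_sum.1 hQ.1).2.1
  have h : ∀ i ∈ (univ : Finset (Fin n)), ∑ j ∈ univ.filter fun j => A i j ≠ 0,
      ((1 - Q i j) * Real.log (1 - Q i j) - Q i j * Real.log (Q i j)) ≤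
        Real.log (k * (((k : ℝ) - 1) / k) ^ (k - 1)) := by
    intro i _
    have h1 := sum_bethe_row_le (s := univ.filter fun j => A i j ≠ 0) (q := Q i)
      (by rw [hA.card_row]; exact hk) (fun j _ => nonneg_of_mem_doublyStochastic hQ.1) (by
        rw [← hrow i]
        refine sum_subset (subset_univ _) fun j _ hj => hQ.2 i j ?_
        simpa using hj)
    rwa [hA.card_row] at h1
  refine (sum_le_card_nsmul _ _ _ h).trans_eq ?_
  simp

theorem IsRegularZeroOne.smul_mem_betheDomain {n k : ℕ} (hk : 2 ≤ k)
    {A : Matrix (Fin n) (Fin n) ℝ} (hA : IsRegularZeroOne k A) :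
    (Matrix.of fun i j => A i j / k) ∈ betheDomain A := by
  have hk0 : (k : ℝ) ≠ 0 := by positivity
  refine ⟨mem_doublyStochastic_iff_sum.2 ⟨fun i j => ?_, fun i => ?_, fun j => ?_⟩,
    fun i j h => by simp [h]⟩
  · exact div_nonneg (hA.nonneg i j) (by positivity)
  · simp only [Matrix.of_apply]
    rw [← sum_div, hA.row_sum, div_self hk0]
  · simp only [Matrix.of_apply]
    rw [← sum_div, hA.col_sum, div_self hk0]

theorem IsRegularZeroOne.betheCW_smul {n k : ℕ} (hk : 2 ≤ k)
    {A : Matrix (Fin n) (Fin n) ℝ} (hA : IsRegularZeroOne k A) :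
    betheCW A (Matrix.of fun i j => A i j / k) =
      n * Real.log (k * (((k : ℝ) - 1) / k) ^ (k - 1)) := by
  rw [hA.betheCW_eq (hA.smul_mem_betheDomain hk).2]
  have hk2 : (2 : ℝ) ≤ k := by exact_mod_cast hk
  have hk0 : (k : ℝ) ≠ 0 := by positivity
  have hk1 : (k : ℝ) - 1 ≠ 0 := by linarith
  have hrow : ∀ i, ∑ j ∈ univ.filter fun j => A i j ≠ 0,
      ((1 - A i j / k) * Real.log (1 - A i j / k) - A i j / k * Real.log (A i j / k)) =
        Real.log (k * (((k : ℝ) - 1) / k) ^ (k - 1)) := by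
    intro i
    have h1 : ∀ j ∈ univ.filter fun j => A i j ≠ 0,
        ((1 - A i j / k) * Real.log (1 - A i j / k) - A i j / k * Real.log (A i j / k)) =
          (1 - 1 / (k : ℝ)) * Real.log (1 - 1 / k) - 1 / k * Real.log (1 / k) := by
      intro j hj
      rw [(hA.zero_or_one i j).resolve_left (mem_filter.1 hj).2]
    rw [sum_congr rfl h1, sum_const, hA.card_row, nsmul_eq_mul,
      Real.log_mul hk0 (pow_ne_zero _ (div_ne_zero hk1 hk0)), Real.log_pow,
      show 1 - 1 / (k : ℝ) = (k - 1) / k by field_simp, one_div, Real.log_inv,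
      Nat.cast_sub (by omega)]
    field_simp
    push_cast
    ring
  simp only [Matrix.of_apply, hrow, sum_const, card_univ, Fintype.card_fin, nsmul_eq_mul]

theorem IsRegularZeroOne.bethePermanent_eq {n k : ℕ} (hk : 2 ≤ k)
    {A : Matrix (Fin n) (Fin n) ℝ} (hA : IsRegularZeroOne k A) :
    bethePermanent A = schrijverBound k n := by
  have hk2 : (2 : ℝ) ≤ k := by exact_mod_cast hk
  have hM0 : (0 : ℝ) < k * (((k : ℝ) - 1) / k) ^ (k - 1) :=
    mul_pos (by linarith) (pow_pos (div_pos (by linarith) (by linarith)) _)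
  have hexp : schrijverBound k n =
      Real.exp (n * Real.log (k * (((k : ℝ) - 1) / k) ^ (k - 1))) := by
    rw [schrijverBound_eq hk, Real.exp_nat_mul, Real.exp_log hM0]
  rw [hexp]
  refine IsGreatest.csSup_eq ⟨⟨_, hA.smul_mem_betheDomain hk, ?_⟩, ?_⟩
  · simp only [hA.betheCW_smul hk]
  · rintro _ ⟨Q, hQ, rfl⟩
    exact Real.exp_le_exp.2 (hA.betheCW_le hk hQ)

end Bethe

/-! ### Perfect matchings, bi-adjacency matrices and the minimum. -/

section Graphs

open Finset SimpleGraph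

theorem SimpleGraph.degree_eq_card_of_equiv_sum {V α β : Type*} {G : SimpleGraph V}
    [G.LocallyFinite] (e : α ⊕ β ≃ V)
    (h : ∀ i j, ¬ G.Adj (e (Sum.inl i)) (e (Sum.inl j))) (i : α) :
    G.degree (e (Sum.inl i)) = Nat.card {j // G.Adj (e (Sum.inl i)) (e (Sum.inr j))} := by
  rw [← card_neighborSet_eq_degree, ← Nat.card_eq_fintype_card]
  refine (Nat.card_congr (Equiv.ofBijective
    (fun j => (⟨e (Sum.inr j.1), j.2⟩ : G.neighborSet (e (Sum.inl i)))) ⟨?_, ?_⟩)).symm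
  · intro j j' hjj
    simpa [Subtype.ext_iff] using hjj
  · rintro ⟨v, hv⟩
    obtain ⟨x, rfl⟩ := e.surjective v
    rcases x with j | j
    · exact absurd hv (h i j)
    · exact ⟨⟨j, hv⟩, rfl⟩

theorem IsBiadjacencyMatrix.transpose {V : Type*} {n : ℕ} {G : SimpleGraph V}
    {A : Matrix (Fin n) (Fin n) ℝ} (hA : IsBiadjacencyMatrix G A) :
    IsBiadjacencyMatrix G A.transpose := by
  obtain ⟨e, h1, h2, h3⟩ := hA
  refine ⟨(Equiv.sumComm _ _).trans e, fun i j => h2 i j, fun i j => h1 i j, fun i j => ?_⟩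
  simpa [G.adj_comm] using h3 j i

theorem IsBiadjacencyMatrix.row_sum {V : Type*} {n k : ℕ} {G : SimpleGraph V} [G.LocallyFinite]
    (hG : G.IsRegularOfDegree k) {A : Matrix (Fin n) (Fin n) ℝ} (hA : IsBiadjacencyMatrix G A)
    (i : Fin n) : ∑ j, A i j = k := by
  classical
  obtain ⟨e, h1, h2, h3⟩ := hA
  have h := degree_eq_card_of_equiv_sum e h1 i
  rw [hG, Nat.card_eq_fintype_card, Fintype.card_subtype, card_filter] at h
  rw [h, Nat.cast_sum]
  refine sum_congr rfl fun j _ => ?_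
  rcases h3 i j with ⟨hadj, hAij⟩ | ⟨hadj, hAij⟩ <;> simp [hadj, hAij]

theorem IsBiadjacencyMatrix.isRegularZeroOne {V : Type*} {n k : ℕ} {G : SimpleGraph V}
    [G.LocallyFinite] (hG : G.IsRegularOfDegree k) {A : Matrix (Fin n) (Fin n) ℝ}
    (hA : IsBiadjacencyMatrix G A) : IsRegularZeroOne k A where
  zero_or_one i j := by
    obtain ⟨e, -, -, h3⟩ := hA
    rcases h3 i j with h | h
    · exact Or.inr h.2
    · exact Or.inl h.2
  row_sum := hA.row_sum hG
  col_sum := hA.transpose.row_sum hG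

/-- Counting edges from both colour classes gives `k` times either size, so for `k > 0` the classes
are equally large. -/
theorem exists_isBiadjacencyMatrix {V : Type*} [Fintype V] {n k : ℕ} (hk : 0 < k)
    {G : SimpleGraph V} [G.LocallyFinite] (hcard : Fintype.card V = 2 * n) (hbip : G.IsBipartite)
    (hG : G.IsRegularOfDegree k) : ∃ A : Matrix (Fin n) (Fin n) ℝ, IsBiadjacencyMatrix G A := by
  classical
  obtain ⟨c⟩ := hbip
  have hc : ∀ v, ¬ c v = 0 → c v = 1 := fun v h => by omega
  have hwith : G.IsBipartiteWith (univ.filter fun v => c v = 0 : Finset V)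
      (univ.filter fun v => ¬ c v = 0 : Finset V) := by
    refine ⟨?_, fun v w hvw => ?_⟩
    · rw [disjoint_coe]
      exact disjoint_filter_filter_not _ _ _
    · have hne := c.valid hvw
      simp only [coe_filter, mem_univ, true_and, Set.mem_ofPred_eq]
      by_cases h : c v = 0
      · exact Or.inl ⟨h, fun h' => hne (h.trans h'.symm)⟩
      · refine Or.inr ⟨h, ?_⟩
        by_contra h'
        exact hne ((hc v h).trans (hc w h').symm)
  have hdeg := isBipartiteWith_sum_degrees_eq hwith
  simp only [hG.degree_eq, sum_const, smul_eq_mul] at hdeg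
  have heq := Nat.eq_of_mul_eq_mul_right hk hdeg
  have hadd := card_filter_add_card_filter_not (s := (univ : Finset V)) (fun v => c v = 0)
  rw [card_univ, hcard] at hadd
  have hl : Fintype.card {v // c v = 0} = n := by rw [Fintype.card_subtype]; omega
  have hr : Fintype.card {v // ¬ c v = 0} = n := by rw [Fintype.card_subtype]; omega
  refine ⟨fun i j => if G.Adj ((Fintype.equivFinOfCardEq hl).symm i)
    ((Fintype.equivFinOfCardEq hr).symm j) then 1 else 0, (Equiv.sumCongr (Fintype.equivFinOfCardEq hl).symm
    (Fintype.equivFinOfCardEq hr).symm).trans (Equiv.sumCompl _), fun i j hij => ?_,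
    fun i j hij => ?_, ?_⟩
  · refine c.valid hij ?_
    simp only [Equiv.trans_apply, Equiv.sumCongr_apply, Sum.map_inl, Equiv.sumCompl_apply_inl]
    exact ((Fintype.equivFinOfCardEq hl).symm i).2.trans
      ((Fintype.equivFinOfCardEq hl).symm j).2.symm
  · refine c.valid hij ?_
    simp only [Equiv.trans_apply, Equiv.sumCongr_apply, Sum.map_inr, Equiv.sumCompl_apply_inr]
    exact (hc _ ((Fintype.equivFinOfCardEq hr).symm i).2).trans
      (hc _ ((Fintype.equivFinOfCardEq hr).symm j).2).symm
  · intro i j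
    simp only [Equiv.trans_apply, Equiv.sumCongr_apply, Sum.map_inl, Sum.map_inr,
      Equiv.sumCompl_apply_inl, Equiv.sumCompl_apply_inr]
    by_cases h : G.Adj ((Fintype.equivFinOfCardEq hl).symm i : V)
      ((Fintype.equivFinOfCardEq hr).symm j : V)
    · exact Or.inl ⟨h, if_pos h⟩
    · exact Or.inr ⟨h, if_neg h⟩

/-- The perfect matching of a bipartite graph that is given by a bijection of the two classes. -/
def matchingOfPerm {V α : Type*} {G : SimpleGraph V} (e : α ⊕ α ≃ V) (σ : Equiv.Perm α)
    (hσ : ∀ i, G.Adj (e (Sum.inl (σ i))) (e (Sum.inr i))) : G.Subgraph where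
  verts := Set.univ
  Adj v w := ∃ i, (v = e (Sum.inl (σ i)) ∧ w = e (Sum.inr i)) ∨
    (v = e (Sum.inr i) ∧ w = e (Sum.inl (σ i)))
  adj_sub := by
    rintro v w ⟨i, ⟨rfl, rfl⟩ | ⟨rfl, rfl⟩⟩
    · exact hσ i
    · exact (hσ i).symm
  edge_vert _ := Set.mem_univ _
  symm := ⟨by
    rintro v w ⟨i, ⟨rfl, rfl⟩ | ⟨rfl, rfl⟩⟩
    · exact ⟨i, Or.inr ⟨rfl, rfl⟩⟩
    · exact ⟨i, Or.inl ⟨rfl, rfl⟩⟩⟩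

theorem matchingOfPerm_adj_inl_inr {V α : Type*} {G : SimpleGraph V} (e : α ⊕ α ≃ V)
    (σ : Equiv.Perm α) (hσ : ∀ i, G.Adj (e (Sum.inl (σ i))) (e (Sum.inr i))) (i j : α) :
    (matchingOfPerm e σ hσ).Adj (e (Sum.inl i)) (e (Sum.inr j)) ↔ i = σ j := by
  simp [matchingOfPerm]

theorem isPerfectMatching_matchingOfPerm {V α : Type*} {G : SimpleGraph V} (e : α ⊕ α ≃ V)
    (σ : Equiv.Perm α) (hσ : ∀ i, G.Adj (e (Sum.inl (σ i))) (e (Sum.inr i))) :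
    (matchingOfPerm e σ hσ).IsPerfectMatching := by
  rw [Subgraph.isPerfectMatching_iff]
  intro v
  obtain ⟨x, rfl⟩ := e.surjective v
  rcases x with i | i
  · refine ⟨e (Sum.inr (σ.symm i)), ⟨σ.symm i, Or.inl ⟨by simp, rfl⟩⟩, ?_⟩
    rintro w ⟨j, ⟨h, rfl⟩ | ⟨h, rfl⟩⟩
    · simp only [EmbeddingLike.apply_eq_iff_eq, Sum.inl.injEq] at h
      simp [h]
    · simp at h
  · refine ⟨e (Sum.inl (σ i)), ⟨i, Or.inr ⟨rfl, rfl⟩⟩, ?_⟩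
    rintro w ⟨j, ⟨h, rfl⟩ | ⟨h, rfl⟩⟩
    · simp at h
    · simp only [EmbeddingLike.apply_eq_iff_eq, Sum.inr.injEq] at h
      simp [h]

/-- Sending a right vertex to its partner is injective by uniqueness of partners, hence bijective by
finiteness. -/
theorem exists_eq_matchingOfPerm {V α : Type*} [Finite α] {G : SimpleGraph V} (e : α ⊕ α ≃ V)
    (h1 : ∀ i j, ¬ G.Adj (e (Sum.inl i)) (e (Sum.inl j)))
    (h2 : ∀ i j, ¬ G.Adj (e (Sum.inr i)) (e (Sum.inr j)))
    {M : G.Subgraph} (hM : M.IsPerfectMatching) :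
    ∃ (σ : Equiv.Perm α) (hσ : ∀ i, G.Adj (e (Sum.inl (σ i))) (e (Sum.inr i))),
      matchingOfPerm e σ hσ = M := by
  have hex : ∀ i, ∃ j, M.Adj (e (Sum.inl j)) (e (Sum.inr i)) := by
    intro i
    obtain ⟨w, hw, -⟩ := Subgraph.isPerfectMatching_iff.1 hM (e (Sum.inr i))
    obtain ⟨x, rfl⟩ := e.surjective w
    rcases x with j | j
    · exact ⟨j, hw.symm⟩
    · exact absurd hw.adj_sub (h2 i j)
  choose f hf using hex
  have hinj : Function.Injective f := by
    intro i j hij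
    have h := hf j
    rw [← hij] at h
    simpa using hM.1.eq_of_adj_left (hf i) h
  obtain ⟨σ, rfl⟩ : ∃ σ : Equiv.Perm α, σ = f :=
    ⟨Equiv.ofBijective f (Finite.injective_iff_bijective.1 hinj), rfl⟩
  refine ⟨σ, fun i => (hf i).adj_sub, ?_⟩
  have hadj : ∀ i j, M.Adj (e (Sum.inl i)) (e (Sum.inr j)) ↔ i = σ j := fun i j =>
    ⟨fun h => by simpa using hM.1.eq_of_adj_right h (hf j), fun h => h ▸ hf j⟩
  refine Subgraph.ext ?_ ?_
  · exact (Set.eq_univ_of_forall fun v => hM.2 v).symm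
  · ext v w
    obtain ⟨x, rfl⟩ := e.surjective v
    obtain ⟨y, rfl⟩ := e.surjective w
    rcases x with i | i <;> rcases y with j | j
    · exact iff_of_false (fun h => h1 i j h.adj_sub) fun h => h1 i j h.adj_sub
    · rw [matchingOfPerm_adj_inl_inr, hadj]
    · rw [Subgraph.adj_comm, matchingOfPerm_adj_inl_inr, Subgraph.adj_comm, hadj]
    · exact iff_of_false (fun h => h2 i j h.adj_sub) fun h => h2 i j h.adj_sub

/-- A permutation contributes 1 when all its edges are present and 0 otherwise. Sending right
vertices to left ones fits the factors `A (σ i) i` of `Matrix.permanent`. -/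
theorem IsBiadjacencyMatrix.numPerfectMatchings_eq_permanent {V : Type*} {n : ℕ}
    {G : SimpleGraph V} {A : Matrix (Fin n) (Fin n) ℝ} (hA : IsBiadjacencyMatrix G A) :
    (numPerfectMatchings G : ℝ) = A.permanent := by
  classical
  obtain ⟨e, h1, h2, h3⟩ := hA
  have hcard : numPerfectMatchings G =
      Nat.card {σ : Equiv.Perm (Fin n) // ∀ i, G.Adj (e (Sum.inl (σ i))) (e (Sum.inr i))} := by
    refine (Nat.card_congr (Equiv.ofBijective (fun σ => (⟨matchingOfPerm e σ.1 σ.2,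
      isPerfectMatching_matchingOfPerm e σ.1 σ.2⟩ : {M : G.Subgraph // M.IsPerfectMatching}))
      ⟨?_, ?_⟩)).symm
    · rintro ⟨σ, hσ⟩ ⟨τ, hτ⟩ hστ
      have h : matchingOfPerm e σ hσ = matchingOfPerm e τ hτ := congrArg Subtype.val hστ
      refine Subtype.ext (Equiv.ext fun i => ?_)
      rw [← matchingOfPerm_adj_inl_inr e τ hτ, ← h, matchingOfPerm_adj_inl_inr]
    · rintro ⟨M, hM⟩
      obtain ⟨σ, hσ, h⟩ := exists_eq_matchingOfPerm e h1 h2 hM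
      exact ⟨⟨σ, hσ⟩, Subtype.ext h⟩
  rw [hcard, Nat.card_eq_fintype_card, Fintype.card_subtype, card_filter, Nat.cast_sum,
    Matrix.permanent]
  refine sum_congr rfl fun σ _ => ?_
  by_cases h : ∀ i, G.Adj (e (Sum.inl (σ i))) (e (Sum.inr i))
  · rw [if_pos h, Nat.cast_one]
    refine (prod_eq_one fun i _ => ?_).symm
    exact ((h3 (σ i) i).resolve_right fun h' => h'.1 (h i)).2
  · rw [if_neg h, Nat.cast_zero]
    obtain ⟨i, hi⟩ := not_forall.1 h
    exact (prod_eq_zero (f := fun i => A (σ i) i) (mem_univ i)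
      ((h3 (σ i) i).resolve_left fun h' => hi h'.1).2).symm

/-- The bipartite graph with a given adjacency relation between its two classes. -/
def bipartiteOfRel {V α β : Type*} (e : α ⊕ β ≃ V) (R : α → β → Prop) : SimpleGraph V where
  Adj v w := ∃ i j, R i j ∧ ((v = e (Sum.inl i) ∧ w = e (Sum.inr j)) ∨
    (v = e (Sum.inr j) ∧ w = e (Sum.inl i)))
  symm := ⟨by
    rintro v w ⟨i, j, h, ⟨rfl, rfl⟩ | ⟨rfl, rfl⟩⟩
    · exact ⟨i, j, h, Or.inr ⟨rfl, rfl⟩⟩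
    · exact ⟨i, j, h, Or.inl ⟨rfl, rfl⟩⟩⟩
  loopless := ⟨by
    rintro v ⟨i, j, h, ⟨rfl, h'⟩ | ⟨rfl, h'⟩⟩ <;> simp at h'⟩

theorem isBipartite_bipartiteOfRel {V α β : Type*} (e : α ⊕ β ≃ V) (R : α → β → Prop) :
    (bipartiteOfRel e R).IsBipartite := by
  refine ⟨Coloring.mk (fun v => Sum.elim (fun _ => 0) (fun _ => 1) (e.symm v)) ?_⟩
  rintro v w ⟨i, j, h, ⟨rfl, rfl⟩ | ⟨rfl, rfl⟩⟩ <;> simp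

/-- The witness is circulant: `i` is joined to `j` when `j - i` modulo `n` is below `k`. -/
theorem exists_isBipartite_isRegularOfDegree {k n : ℕ} (hn : 1 ≤ n) (hkn : k ≤ n) :
    ∃ G : SimpleGraph (Fin (2 * n)), G.IsBipartite ∧
      ∀ [G.LocallyFinite], G.IsRegularOfDegree k := by
  have : NeZero n := ⟨by omega⟩
  have e : Fin n ⊕ Fin n ≃ Fin (2 * n) := finSumFinEquiv.trans (finCongr (two_mul n).symm)
  set G := bipartiteOfRel e fun i j => ((j - i : Fin n) : ℕ) < k with hG
  have hinl : ∀ i j, ¬ G.Adj (e (Sum.inl i)) (e (Sum.inl j)) := fun i j => by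
    simp [hG, bipartiteOfRel]
  have hinr : ∀ i j, ¬ G.Adj (e (Sum.inr i)) (e (Sum.inr j)) := fun i j => by
    simp [hG, bipartiteOfRel]
  have hadj : ∀ i j, G.Adj (e (Sum.inl i)) (e (Sum.inr j)) ↔ ((j - i : Fin n) : ℕ) < k :=
    fun i j => by simp [hG, bipartiteOfRel]
  have hcard : Nat.card {j : Fin n // (j : ℕ) < k} = k := by
    rw [← Nat.card_congr (Fin.castLEquiv hkn), Nat.card_fin]
  refine ⟨G, isBipartite_bipartiteOfRel _ _, fun v => ?_⟩
  obtain ⟨x, rfl⟩ := e.surjective v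
  rcases x with i | i
  · rw [degree_eq_card_of_equiv_sum e hinl]
    refine (Nat.card_congr ((Equiv.subRight i).subtypeEquiv fun j => ?_)).trans hcard
    rw [hadj]
    rfl
  · have h := degree_eq_card_of_equiv_sum ((Equiv.sumComm _ _).trans e) (fun i j => hinr i j) i
    refine h.trans ?_
    refine (Nat.card_congr ((Equiv.subLeft i).subtypeEquiv fun j => ?_)).trans hcard
    simp only [Equiv.trans_apply, Equiv.sumComm_apply, Sum.swap_inl, Sum.swap_inr]
    rw [G.adj_comm, hadj]
    rfl

theorem schrijverBound_lt_numPerfectMatchings {V : Type*} [Fintype V] {k n : ℕ} (hk : 2 ≤ k)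
    (hn : 1 ≤ n) {G : SimpleGraph V} [G.LocallyFinite] (hcard : Fintype.card V = 2 * n)
    (hbip : G.IsBipartite) (hG : G.IsRegularOfDegree k) :
    schrijverBound k n < (numPerfectMatchings G : ℝ) := by
  obtain ⟨A, hA⟩ := exists_isBiadjacencyMatrix (by omega) hcard hbip hG
  rw [hA.numPerfectMatchings_eq_permanent]
  exact (hA.isRegularZeroOne hG).schrijverBound_lt_permanent hk hn

theorem schrijverBound_lt_minPerfectMatchings {k n : ℕ} (hk : 2 ≤ k) (hn : 1 ≤ n) (hkn : k ≤ n) :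
    schrijverBound k n < (minPerfectMatchings k n : ℝ) := by
  classical
  obtain ⟨G₀, hbip₀, hG₀⟩ := exists_isBipartite_isRegularOfDegree hn hkn
  -- Nonemptiness matters: `sInf` is attained on a nonempty set of naturals, but is 0 on the empty
  -- one.
  have hmin : ∀ S : Set ℕ, S.Nonempty → (∀ m ∈ S, schrijverBound k n < (m : ℝ)) →
      schrijverBound k n < (sInf S : ℕ) := fun S hS h => h _ (Nat.sInf_mem hS)
  refine hmin _ ⟨_, G₀, hbip₀, hG₀, rfl⟩ ?_
  rintro _ ⟨G, hbip, hG, rfl⟩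
  exact schrijverBound_lt_numPerfectMatchings hk hn (by simp) hbip hG

end Graphs

theorem mainTheorem12 (k n : ℕ) (hk : 2 ≤ k) (hn : 1 ≤ n) :
    (k ≤ n → schrijverBound k n < (minPerfectMatchings k n : ℝ)) ∧
    ∀ {V : Type*} [Fintype V] (G : SimpleGraph V) [G.LocallyFinite],
      Fintype.card V = 2 * n → G.IsBipartite → G.IsRegularOfDegree k →
        schrijverBound k n < (numPerfectMatchings G : ℝ) ∧
        (∃ A : Matrix (Fin n) (Fin n) ℝ, IsBiadjacencyMatrix G A) ∧
        ∀ A : Matrix (Fin n) (Fin n) ℝ, IsBiadjacencyMatrix G A →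
          (numPerfectMatchings G : ℝ) = A.permanent ∧
          bethePermanent A < A.permanent ∧
          bethePermanent A = schrijverBound k n := by
  refine ⟨schrijverBound_lt_minPerfectMatchings hk hn, fun G _ hcard hbip hG =>
    ⟨schrijverBound_lt_numPerfectMatchings hk hn hcard hbip hG,
      exists_isBiadjacencyMatrix (by omega) hcard hbip hG, fun A hA => ?_⟩⟩
  have hreg := hA.isRegularZeroOne hG
  refine ⟨hA.numPerfectMatchings_eq_permanent, ?_, hreg.bethePermanent_eq hk⟩
  rw [hreg.bethePermanent_eq hk]
  exact hreg.schrijverBound_lt_permanent hk hn
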